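/- For a continuous $2\pi$-periodic function $f:\mathbb R\to\mathbb R$ put $\|f\|_C=\max_x|f(x)|$, let $a_k(f)=\frac1\pi\int_{-\pi}^{\pi}f(t)\cos kt\,dt$ and $b_k(f)=\frac1\pi\int_{-\pi}^{\pi}f(t)\sin kt\,dt$ be its Fourier coefficients, let $S_k(f;x)=\frac{a_0(f)}2+\sum_{j=1}^{k}\bigl(a_j(f)\cos jx+b_j(f)\sin jx\bigr)$ be its Fourier sum of order $k$, and for integers $1\le p\le n$ let $$V_{n,p}(f;x)=\frac1p\sum_{k=n-p}^{n-1}S_k(f;x)$$ be its de la Vallée Poussin sum. For $0<\alpha\le 1$ let $H^\alpha$ be the class of continuous $2\pi$-periodic functions $f:\mathbb R\to\mathbb R$ with $|f(x')-f(x'')|\le|x'-x''|^\alpha$ for all $x',x''\in\mathbb R$, and put $$\mathcal E(H^\alpha;V_{n,p})=\sup_{f\in H^\alpha}\|f(\cdot)-V_{n,p}(f;\cdot)\|_C .$$ Then for every even positive integer $n$ and every $0<\alpha\le1$ this supremum is finite for $p=n/2$, and $$\frac{1}{\alpha+1}\,\frac{\pi^\alpha}{n^\alpha}\;\le\;\mathcal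 E(H^\alpha;V_{n,n/2})\;<\;\Bigl(\frac{6^\alpha}{7^\alpha}+\frac{3^{2-\alpha}2^{\alpha-1}}{5\pi}+\frac{31}{25\pi}\Bigr)\frac{\pi^\alpha}{n^\alpha}.$$ In particular, $$\frac{\pi}{2n}\le\mathcal E(H^1;V_{n,n/2})<\frac{1.443\,\pi}{n},\qquad \frac23\sqrt{\frac{\pi}{n}}\le\mathcal E(H^{1/2};V_{n,n/2})<1.555\sqrt{\frac{\pi}{n}} .$$ -/

import Mathlib

noncomputable section

namespace ValleePoussin

/-- The cosine Fourier coefficient `a_k(f) = (1/π) ∫_{-π}^{π} f(t) cos(kt) dt`. -/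
def cosCoeff (f : ℝ → ℝ) (k : ℕ) : ℝ :=
  (1 / Real.pi) * ∫ t in (-Real.pi)..Real.pi, f t * Real.cos (k * t)

/-- The sine Fourier coefficient `b_k(f) = (1/π) ∫_{-π}^{π} f(t) sin(kt) dt`. -/
def sinCoeff (f : ℝ → ℝ) (k : ℕ) : ℝ :=
  (1 / Real.pi) * ∫ t in (-Real.pi)..Real.pi, f t * Real.sin (k * t)

/-- The partial Fourier sum `S_k(f; x)` of order `k`. -/
def fourierSum (k : ℕ) (f : ℝ → ℝ) (x : ℝ) : ℝ :=
  cosCoeff f 0 / 2 +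
    ∑ j ∈ Finset.Icc 1 k,
      (cosCoeff f j * Real.cos (j * x) + sinCoeff f j * Real.sin (j * x))

/-- The de la Vallée Poussin sum `V_{n,p}(f; x) = (1/p) ∑_{k=n-p}^{n-1} S_k(f; x)`,
for `1 ≤ p ≤ n`. -/
def vpSum (n p : ℕ) (f : ℝ → ℝ) (x : ℝ) : ℝ :=
  (1 / (p : ℝ)) * ∑ k ∈ Finset.Ico (n - p) n, fourierSum k f x

/-- The space `C` of continuous `2π`-periodic functions on the real line. -/
def periodicC : Set (ℝ → ℝ) :=
  {f | Continuous f ∧ Function.Periodic f (2 * Real.pi)}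

/-- The uniform norm of a function; on `periodicC` the supremum is an attained maximum. -/
def normC (f : ℝ → ℝ) : ℝ := ⨆ x : ℝ, |f x|

/-- The class `H_ω` of continuous `2π`-periodic functions `f` with
`|f(x') - f(x'')| ≤ ω(|x' - x''|)` for all real `x'`, `x''`. -/
def classH (ω : ℝ → ℝ) : Set (ℝ → ℝ) :=
  {f | f ∈ periodicC ∧ ∀ x y : ℝ, |f x - f y| ≤ ω |x - y|}

/-- The Hölder class `H^α`, that is `H_ω` with `ω(t) = t^α`. -/
def holderClass (α : ℝ) : Set (ℝ → ℝ) := classH fun t => t ^ α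

/-- The set of the deviations `‖f - V_{n,p}(f)‖_C`, where `f` runs over the class `H`. -/
def deviations (H : Set (ℝ → ℝ)) (n p : ℕ) : Set ℝ :=
  (fun f : ℝ → ℝ => normC fun x => f x - vpSum n p f x) '' H

/-- The quantity `E(H; V_{n,p}) = sup_{f ∈ H} ‖f - V_{n,p}(f)‖_C`. -/
def devSup (H : Set (ℝ → ℝ)) (n p : ℕ) : ℝ := sSup (deviations H n p)

end ValleePoussin

end

namespace ValleePoussin

open Real intervalIntegral Set

/-! Write `n = 2m`. On periodic functions the sum is convolution with `vpKernel m / m`, and the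
upper bound comes from two estimates of the error `f - V f`. If `|e| ≤ δ`, the error is at most
`153/56 * δ`, from an L¹ bound on the kernel (`integral_abs_vpKernel_le`). If `f` is `b`-Lipschitz,
integration by parts against the tail of the kernel gives `7b/(mπ)`, because the tail has L¹ norm at
most `3.5` (`integral_abs_vpTail_le`).

A Hölder function interpolates between the two. The tangent to `t ^ α` at `π/n` gives `|f x - f y| ≤
a + b|x - y|`, so `f` is within `a/2` of a `b`-Lipschitz function
(`exists_lipschitzWith_abs_sub_le`). Adding the two errors yields `1.43 (π/n)^α` for every `α`,
which is below all three stated upper constants.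

For the lower bound, the `α`-th power of the distance to `(2π/n)ℤ` has no harmonics of orders `1, …,
n - 1`. Its sum is therefore its mean, and the deviation at `0` equals the claimed bound. -/

/-! ### Kernels: closed forms and integrals -/

/-- The Dirichlet kernel `1/2 + ∑_{j=1}^k cos (j t)`. -/
noncomputable def dirichletKernel (k : ℕ) (t : ℝ) : ℝ := 1 / 2 + ∑ j ∈ Finset.Icc 1 k, cos (j * t)

/-- The sum of the first `N` Dirichlet kernels, `N` times the Fejér kernel. -/
noncomputable def fejerSum (N : ℕ) (t : ℝ) : ℝ := ∑ k ∈ Finset.range N, dirichletKernel k t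

/-- The de la Vallée Poussin kernel for `n = 2 m`, `p = m`, multiplied by `m`. -/
noncomputable def vpKernel (m : ℕ) (t : ℝ) : ℝ := fejerSum (2 * m) t - fejerSum m t

/-- Keeping the denominator multiplied out avoids the singularity at `t = 0` and makes the sum over
`k` telescope. -/
lemma two_mul_one_sub_cos_mul_dirichletKernel (k : ℕ) (t : ℝ) :
    2 * (1 - cos t) * dirichletKernel k t = cos (k * t) - cos ((k + 1 : ℕ) * t) := by
  induction k with
  | zero => simp [dirichletKernel]; ring
  | succ k ih =>
    have h : dirichletKernel (k + 1) t = dirichletKernel k t + cos ((k + 1 : ℕ) * t) := by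
      simp only [dirichletKernel]
      rw [Finset.sum_Icc_succ_top (by omega)]; ring
    have e1 : ((k + 1 + 1 : ℕ) : ℝ) * t = (k + 1 : ℕ) * t + t := by push_cast; ring
    have e2 : (k : ℝ) * t = (k + 1 : ℕ) * t - t := by push_cast; ring
    rw [h, mul_add, ih, e1, e2, cos_add, cos_sub]
    ring

lemma two_mul_one_sub_cos_mul_fejerSum (N : ℕ) (t : ℝ) :
    2 * (1 - cos t) * fejerSum N t = 1 - cos (N * t) := by
  simp only [fejerSum]
  rw [Finset.mul_sum, Finset.sum_congr rfl fun k _ =>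
    two_mul_one_sub_cos_mul_dirichletKernel k t,
    Finset.sum_range_sub' (fun k : ℕ => cos (k * t))]
  simp

lemma two_mul_one_sub_cos_mul_vpKernel (m : ℕ) (t : ℝ) :
    2 * (1 - cos t) * vpKernel m t = cos (m * t) - cos (2 * (m * t)) := by
  have e : ((2 * m : ℕ) : ℝ) * t = 2 * (m * t) := by push_cast; ring
  rw [vpKernel, mul_sub, two_mul_one_sub_cos_mul_fejerSum, two_mul_one_sub_cos_mul_fejerSum, e]
  ring

@[fun_prop]
lemma continuous_dirichletKernel (k : ℕ) : Continuous (dirichletKernel k) := by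
  unfold dirichletKernel; fun_prop

@[fun_prop]
lemma continuous_fejerSum (N : ℕ) : Continuous (fejerSum N) := by
  unfold fejerSum; fun_prop

@[fun_prop]
lemma continuous_vpKernel (m : ℕ) : Continuous (vpKernel m) := by
  unfold vpKernel; fun_prop

lemma integral_dirichletKernel (k : ℕ) : ∫ t in 0..π, dirichletKernel k t = π / 2 := by
  simp only [dirichletKernel]
  rw [integral_add (by simp) (Continuous.intervalIntegrable (by fun_prop) _ _),
    integral_finsetSum fun j _ => Continuous.intervalIntegrable (by fun_prop) _ _]
  rw [Finset.sum_eq_zero]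
  · simp; ring
  · intro j hj
    have hj' : (j : ℝ) ≠ 0 := by
      have := (Finset.mem_Icc.1 hj).1
      positivity
    rw [integral_comp_mul_left _ hj']
    simp [sin_nat_mul_pi]

lemma integral_fejerSum (N : ℕ) : ∫ t in 0..π, fejerSum N t = N * (π / 2) := by
  simp only [fejerSum]
  rw [integral_finsetSum fun j _ => Continuous.intervalIntegrable (by fun_prop) _ _]
  simp [integral_dirichletKernel]

lemma integral_vpKernel (m : ℕ) : ∫ t in 0..π, vpKernel m t = m * (π / 2) := by
  simp only [vpKernel]
  rw [integral_sub (Continuous.intervalIntegrable (by fun_prop) _ _)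
    (Continuous.intervalIntegrable (by fun_prop) _ _), integral_fejerSum, integral_fejerSum]
  push_cast; ring

lemma one_sub_cos_pos {t : ℝ} (h0 : 0 < t) (h1 : t ≤ π) : 0 < 1 - cos t := by
  have := cos_lt_cos_of_nonneg_of_le_pi le_rfl h1 h0
  rw [cos_zero] at this
  linarith

/-! ### L¹ norm of the kernel -/

/-- With `c = cos u` and `y = |1 + 2c|`, the left side is `(1 - c) y` and `1 - cos 3u = (1 - c) y²`.
What remains is AM-GM, `y ≤ 7/8 + 2/7 y²`, with equality at `y = 7/4`, a rational close to the
optimal `√3`. The right side is a combination of Fejér kernels, whose integrals are explicit. -/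
lemma abs_cos_sub_cos_two_mul_le (u : ℝ) :
    |cos u - cos (2 * u)| ≤ 7 / 8 * (1 - cos u) + 2 / 7 * (1 - cos (3 * u)) := by
  rw [cos_three_mul, cos_two_mul]
  have h1 := cos_le_one u
  have h2 := neg_one_le_cos u
  generalize cos u = c at *
  rw [abs_le]
  constructor <;> nlinarith [mul_nonneg (sub_nonneg.2 h1) (sq_nonneg (c + 1/2 + 7/8)), mul_nonneg (sub_nonneg.2 h1) (sq_nonneg (c + 1/2 - 7/8))]

lemma integral_abs_vpKernel_le (m : ℕ) :
    ∫ t in 0..π, |vpKernel m t| ≤ 97 / 56 * (m * (π / 2)) := by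
  have key : ∫ t in 0..π, |vpKernel m t| ≤
      ∫ t in 0..π, (7 / 8 * fejerSum m t + 2 / 7 * fejerSum (3 * m) t) := by
    refine integral_mono_on_of_le_Ioo pi_pos.le (Continuous.intervalIntegrable (by fun_prop) _ _)
      (Continuous.intervalIntegrable (by fun_prop) _ _) fun t ht => ?_
    have hq := one_sub_cos_pos ht.1 ht.2.le
    have h := abs_cos_sub_cos_two_mul_le (m * t)
    have e : 3 * (m * t) = ((3 * m : ℕ) : ℝ) * t := by push_cast; ring
    rw [e, ← two_mul_one_sub_cos_mul_vpKernel, ← two_mul_one_sub_cos_mul_fejerSum,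
      ← two_mul_one_sub_cos_mul_fejerSum, abs_mul, abs_of_pos (by linarith)] at h
    refine le_of_mul_le_mul_left (h.trans_eq ?_) (by linarith : 0 < 2 * (1 - cos t))
    ring
  refine key.trans_eq ?_
  rw [integral_add (Continuous.intervalIntegrable (by fun_prop) _ _)
    (Continuous.intervalIntegrable (by fun_prop) _ _), integral_const_mul, integral_const_mul,
    integral_fejerSum, integral_fejerSum]
  push_cast; ring

/-! ### L¹ norm of the tail of the kernel -/

/-- The tail integral `∫_t^π` of `vpKernel m`. -/
noncomputable def vpTail (m : ℕ) (t : ℝ) : ℝ := m * (π / 2) - ∫ s in 0..t, vpKernel m s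

lemma vpTail_zero (m : ℕ) : vpTail m 0 = m * (π / 2) := by simp [vpTail]

lemma vpTail_pi (m : ℕ) : vpTail m π = 0 := by simp [vpTail, integral_vpKernel]

lemma hasDerivAt_vpTail (m : ℕ) (t : ℝ) : HasDerivAt (vpTail m) (-vpKernel m t) t :=
  ((continuous_vpKernel m).integral_hasStrictDerivAt 0 t).hasDerivAt.const_sub _

@[fun_prop]
lemma continuous_vpTail (m : ℕ) : Continuous (vpTail m) :=
  continuous_iff_continuousAt.2 fun t => (hasDerivAt_vpTail m t).continuousAt

/-- The square `(1 - c)³(1 + c)` is largest at `c = cos u = -1/2`, with value `27/16 < 1.3²`. -/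
lemma abs_sin_sub_sin_two_mul_div_two_le (u : ℝ) : |sin u - sin (2 * u) / 2| ≤ 1.3 := by
  apply abs_le_of_sq_le_sq _ (by norm_num)
  have e : (sin u - sin (2 * u) / 2) ^ 2 = (1 - cos u) ^ 3 * (1 + cos u) := by
    rw [sin_two_mul]
    linear_combination (1 - cos u) ^ 2 * sin_sq_add_cos_sq u
  rw [e]
  nlinarith [mul_nonneg (sq_nonneg (cos u + 1 / 2))
    (add_nonneg (sq_nonneg (cos u - 3 / 2)) (by norm_num : (0 : ℝ) ≤ 1 / 2))]

/-- One integration by parts: the oscillating numerator of the kernel is integrated exactly. The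
free constant `c` lets the remaining term be given a fixed sign. -/
lemma hasDerivAt_sin_sub_sin_div_one_sub_cos {m : ℕ} (hm : 0 < m) (c : ℝ) {t : ℝ}
    (h0 : 0 < t) (h1 : t ≤ π) :
    HasDerivAt (fun t => (sin (m * t) - sin (2 * (m * t)) / 2 + c) / (m * (2 * (1 - cos t))))
      (vpKernel m t - (sin (m * t) - sin (2 * (m * t)) / 2 + c) *
        (2 * sin t / (m * (2 * (1 - cos t)) ^ 2))) t := by
  have hq := one_sub_cos_pos h0 h1
  have hm' : (0 : ℝ) < m := by exact_mod_cast hm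
  have d1 : HasDerivAt (fun t : ℝ => (m : ℝ) * t) m t := by
    simpa using (hasDerivAt_id t).const_mul (m : ℝ)
  have dn := ((d1.sin).sub ((d1.const_mul 2).sin.div_const 2)).add_const c
  have dd := (((hasDerivAt_cos t).const_sub 1).const_mul 2).const_mul (m : ℝ)
  have h := dn.div dd (by positivity)
  refine h.congr_deriv ?_
  have hk : vpKernel m t = (cos (m * t) - cos (2 * (m * t))) / (2 * (1 - cos t)) := by
    rw [← two_mul_one_sub_cos_mul_vpKernel]; field_simp
  rw [hk]
  simp only [Pi.sub_apply]
  field_simp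

/-- Adding the partial primitive to the tail leaves a derivative whose sign is known once `c = ±1.3`
dominates the sine terms. Comparison with the endpoint `π`, where the tail vanishes, bounds it from
both sides; the factor is `2.6 = 1.3 + 1.3`. -/
lemma abs_vpTail_le {m : ℕ} (hm : 0 < m) {t : ℝ} (h0 : 0 < t) (h1 : t ≤ π) :
    |vpTail m t| ≤ 2.6 / (m * (2 * (1 - cos t))) := by
  have hm' : (0 : ℝ) < m := by exact_mod_cast hm
  have hq := one_sub_cos_pos h0 h1
  have hd : ∀ c : ℝ, ∀ s ∈ Icc t π, HasDerivAt
      (fun t => vpTail m t + (sin (m * t) - sin (2 * (m * t)) / 2 + c) / (m * (2 * (1 - cos t))))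
      (-((sin (m * s) - sin (2 * (m * s)) / 2 + c) *
        (2 * sin s / (m * (2 * (1 - cos s)) ^ 2)))) s := fun c s hs => by
    refine ((hasDerivAt_vpTail m s).add (hasDerivAt_sin_sub_sin_div_one_sub_cos hm c
      (h0.trans_le hs.1) hs.2)).congr_deriv ?_
    ring
  have hw : ∀ s ∈ Icc t π, 0 ≤ 2 * sin s / (m * (2 * (1 - cos s)) ^ 2) := fun s hs => by
    have := sin_nonneg_of_nonneg_of_le_pi (h0.le.trans hs.1) hs.2
    positivity
  have hb := fun s : ℝ => abs_le.1 (abs_sin_sub_sin_two_mul_div_two_le (m * s))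
  have anti := antitoneOn_of_deriv_nonpos (convex_Icc t π)
    (fun s hs => (hd 1.3 s hs).continuousAt.continuousWithinAt)
    (fun s hs => (hd 1.3 s (interior_subset hs)).differentiableAt.differentiableWithinAt)
    (fun s hs => by
      rw [(hd 1.3 s (interior_subset hs)).deriv]
      have := mul_nonneg (by linarith [hb s] :
        0 ≤ sin (m * s) - sin (2 * (m * s)) / 2 + 1.3) (hw s (interior_subset hs))
      linarith)
  have mono := monotoneOn_of_deriv_nonneg (convex_Icc t π)
    (fun s hs => (hd (-1.3) s hs).continuousAt.continuousWithinAt)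
    (fun s hs => (hd (-1.3) s (interior_subset hs)).differentiableAt.differentiableWithinAt)
    (fun s hs => by
      rw [(hd (-1.3) s (interior_subset hs)).deriv]
      have := mul_nonneg (by linarith [hb s] :
        0 ≤ -(sin (m * s) - sin (2 * (m * s)) / 2 + -1.3)) (hw s (interior_subset hs))
      linarith)
  have hA := anti (left_mem_Icc.2 h1) (right_mem_Icc.2 h1) h1
  have hM := mono (left_mem_Icc.2 h1) (right_mem_Icc.2 h1) h1
  have e2 : sin (2 * (m * π)) = 0 := by
    have := sin_nat_mul_pi (2 * m)
    push_cast at this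
    rwa [mul_assoc] at this
  simp only [vpTail_pi, sin_nat_mul_pi, e2, cos_pi] at hA hM
  have hp : (0 : ℝ) ≤ 1.3 / (m * (2 * (1 - -1))) := by positivity
  have hD : (0 : ℝ) < m * (2 * (1 - cos t)) := by positivity
  have hA' : 0 ≤ vpTail m t + (sin (m * t) - sin (2 * (m * t)) / 2 + 1.3) /
      (m * (2 * (1 - cos t))) := by
    refine le_trans ?_ hA
    simpa using hp
  have hM' : vpTail m t + (sin (m * t) - sin (2 * (m * t)) / 2 + -1.3) /
      (m * (2 * (1 - cos t))) ≤ 0 := by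
    refine hM.trans ?_
    rw [show (0 : ℝ) + (0 - 0 / 2 + -1.3) / (m * (2 * (1 - -1))) =
      -(1.3 / (m * (2 * (1 - -1)))) by ring]
    linarith
  have b1 : (sin (m * t) - sin (2 * (m * t)) / 2 + 1.3) / (m * (2 * (1 - cos t))) ≤
      2.6 / (m * (2 * (1 - cos t))) := by
    gcongr; linarith [hb t]
  have b2 : -(2.6 / (m * (2 * (1 - cos t)))) ≤
      (sin (m * t) - sin (2 * (m * t)) / 2 + -1.3) / (m * (2 * (1 - cos t))) := by
    rw [← neg_div]
    gcongr; linarith [hb t]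
  rw [abs_le]
  constructor <;> linarith

lemma one_sub_cos_eq (t : ℝ) : 2 * (1 - cos t) = 4 * sin (t / 2) ^ 2 := by
  have h := cos_two_mul (t / 2)
  rw [mul_div_cancel₀ t two_ne_zero] at h
  rw [h, cos_sq']; ring

lemma integral_abs_vpTail_two_div_le {m : ℕ} (hm : 0 < m) :
    ∫ t in (2 / m : ℝ)..π, |vpTail m t| ≤ 1.3 := by
  have hm' : (1 : ℝ) ≤ m := by exact_mod_cast hm
  have hτ : (2 / m : ℝ) ≤ π := by
    rw [div_le_iff₀ (by positivity)]; nlinarith [pi_gt_three]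
  have hτ0 : (0 : ℝ) < 2 / m := by positivity
  have hs : ∀ t ∈ Icc (2 / m : ℝ) π, 0 < sin (t / 2) := fun t ht =>
    sin_pos_of_pos_of_lt_pi (by linarith [ht.1]) (by linarith [ht.2, pi_pos])
  have hc : ∀ t ∈ Icc (2 / m : ℝ) π, 0 < 2 * (1 - cos t) := fun t ht => by
    linarith [one_sub_cos_pos (hτ0.trans_le ht.1) ht.2]
  have hcont : ContinuousOn (fun t : ℝ => 2.6 / (m * (2 * (1 - cos t)))) (uIcc (2 / m) π) := by
    rw [uIcc_of_le hτ]
    refine ContinuousOn.div (by fun_prop) (by fun_prop) fun t ht => ?_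
    have := hc t ht
    positivity
  -- Since `2(1 - cos t) = 4 sin²(t/2)`, the primitive is a multiple of `cot (t/2)`. It vanishes at
  -- `π`, and `tan x > x` controls it at `2/m`.
  have hprim : ∀ t ∈ uIcc (2 / m : ℝ) π, HasDerivAt
      (fun t => -(1.3 / m) * (cos (t / 2) / sin (t / 2))) (2.6 / (m * (2 * (1 - cos t)))) t := by
    intro t ht
    rw [uIcc_of_le hτ] at ht
    have h := hs t ht
    have dh : HasDerivAt (fun t : ℝ => t / 2) (1 / 2) t := (hasDerivAt_id t).div_const 2
    refine ((dh.cos.div dh.sin h.ne').const_mul (-(1.3 / (m : ℝ)))).congr_deriv ?_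
    rw [one_sub_cos_eq]
    have := sin_sq_add_cos_sq (t / 2)
    field_simp
    linear_combination 5.2 * this
  calc ∫ t in (2 / m : ℝ)..π, |vpTail m t|
      ≤ ∫ t in (2 / m : ℝ)..π, 2.6 / (m * (2 * (1 - cos t))) :=
        integral_mono_on hτ (Continuous.intervalIntegrable (by fun_prop) _ _)
          hcont.intervalIntegrable fun t ht => abs_vpTail_le hm (hτ0.trans_le ht.1) ht.2
    _ = 1.3 / m * (cos (1 / m) / sin (1 / m)) := by
        rw [integral_eq_sub_of_hasDerivAt hprim hcont.intervalIntegrable]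
        have : (2 / m : ℝ) / 2 = 1 / m := by ring
        simp only [this, cos_pi_div_two]
        ring
    _ ≤ 1.3 / m * m := by
        gcongr
        have h1 : (1 / m : ℝ) ≤ 1 := by rw [div_le_one (by positivity)]; exact hm'
        have hlt := lt_tan (x := 1 / m) (by positivity) (by linarith [pi_gt_three])
        have hsin : 0 < sin (1 / m : ℝ) :=
          sin_pos_of_pos_of_lt_pi (by positivity) (by linarith [pi_gt_three])
        have hcos : 0 < cos (1 / m : ℝ) :=
          cos_pos_of_mem_Ioo ⟨by linarith [pi_gt_three, (by positivity : (0 : ℝ) < 1 / m)],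
            by linarith [pi_gt_three]⟩
        rw [tan_eq_sin_div_cos, lt_div_iff₀ hcos] at hlt
        rw [div_le_iff₀ hsin]
        have := mul_le_mul_of_nonneg_left hlt.le (by positivity : (0 : ℝ) ≤ m)
        field_simp at this ⊢
        linarith
    _ = 1.3 := by field_simp

lemma vpKernel_nonneg {m : ℕ} {t : ℝ} (h0 : 0 < t) (h1 : m * t ≤ 2) (h2 : t ≤ π) :
    0 ≤ vpKernel m t := by
  have hq := one_sub_cos_pos h0 h2
  have h := two_mul_one_sub_cos_mul_vpKernel m t
  have hu : 0 ≤ m * t := by positivity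
  have e : cos (m * t) - cos (2 * (m * t)) =
      2 * (sin (3 * (m * t) / 2) * sin (m * t / 2)) := by
    rw [cos_sub_cos, show (m * t + 2 * (m * t)) / 2 = 3 * (m * t) / 2 by ring,
      show (m * t - 2 * (m * t)) / 2 = -(m * t / 2) by ring, sin_neg]
    ring
  -- The cutoff `m t ≤ 2` keeps `3mt/2 ≤ 3 < π`.
  have s1 := sin_nonneg_of_nonneg_of_le_pi (x := 3 * (m * t) / 2) (by positivity)
    (by linarith [pi_gt_three])
  have s2 := sin_nonneg_of_nonneg_of_le_pi (x := m * t / 2) (by positivity)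
    (by linarith [pi_gt_three])
  rw [e] at h
  exact nonneg_of_mul_nonneg_right (h ▸ by positivity) (by linarith : 0 < 2 * (1 - cos t))

lemma le_vpKernel {m : ℕ} {t : ℝ} (h0 : 0 < t) (h1 : m * t ≤ 1) (h2 : t ≤ π) :
    0.63 * m ^ 2 ≤ vpKernel m t := by
  have hq := one_sub_cos_pos h0 h2
  have h := two_mul_one_sub_cos_mul_vpKernel m t
  have hu : 0 ≤ m * t := by positivity
  have hb := one_sub_sq_div_two_le_cos (x := t)
  have c1 := one_sub_sq_div_two_le_cos (x := m * t)
  have c2 : cos (2 * (m * t)) ≤ 1 - 2 * (m * t - (m * t) ^ 3 / 6) ^ 2 := by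
    have hs := sin_ge_sub_cube hu
    have hnn : 0 ≤ m * t - (m * t) ^ 3 / 6 := by nlinarith [sq_nonneg (m * t)]
    rw [cos_two_mul, cos_sq']
    nlinarith [mul_self_le_mul_self hnn hs]
  have key : 0.63 * (m * t) ^ 2 ≤ 2 * (1 - cos t) * vpKernel m t := by
    rw [h]
    generalize (m : ℝ) * t = u at *
    have : u ^ 4 ≤ u ^ 2 := pow_le_pow_of_le_one hu h1 (by norm_num)
    nlinarith [sq_nonneg (u ^ 3)]
  by_contra! hlt
  have : 2 * (1 - cos t) * vpKernel m t ≤ 2 * (1 - cos t) * (0.63 * m ^ 2) := by gcongr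
  rcases eq_or_ne m 0 with rfl | hm
  · simp at key hlt
    nlinarith
  · have hm' : (0 : ℝ) < m := by positivity
    have h3 : 2 * (1 - cos t) * vpKernel m t < 2 * (1 - cos t) * (0.63 * m ^ 2) := by gcongr
    nlinarith [mul_nonneg (sub_nonneg.2 hb) (by positivity : (0 : ℝ) ≤ m ^ 2)]

lemma antitoneOn_vpTail {m : ℕ} (hm : 0 < m) : AntitoneOn (vpTail m) (Icc 0 (2 / m)) := by
  have hm' : (1 : ℝ) ≤ m := by exact_mod_cast hm
  refine antitoneOn_of_deriv_nonpos (convex_Icc _ _) (by fun_prop)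
    (fun s _ => (hasDerivAt_vpTail m s).differentiableAt.differentiableWithinAt) fun s hs => ?_
  rw [interior_Icc] at hs
  have h2 : m * s ≤ 2 := by
    have := hs.2.le
    rwa [le_div_iff₀ (by positivity), mul_comm] at this
  rw [(hasDerivAt_vpTail m s).deriv, neg_nonpos]
  exact vpKernel_nonneg hs.1 h2 (by nlinarith [hs.1, pi_gt_three])

lemma vpTail_le {m : ℕ} (hm : 0 < m) {t : ℝ} (h0 : 0 ≤ t) (h1 : t ≤ 1 / m) :
    vpTail m t ≤ m * (π / 2 - 0.63 * (m * t)) := by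
  have hm' : (1 : ℝ) ≤ m := by exact_mod_cast hm
  have hd : ∀ s, HasDerivAt (fun s => vpTail m s + 0.63 * m ^ 2 * s)
      (-vpKernel m s + 0.63 * m ^ 2) s := fun s => by
    refine ((hasDerivAt_vpTail m s).add
      ((hasDerivAt_id s).const_mul (0.63 * (m : ℝ) ^ 2))).congr_deriv ?_
    rw [mul_one]
  have anti : AntitoneOn (fun s => vpTail m s + 0.63 * m ^ 2 * s) (Icc 0 (1 / m : ℝ)) := by
    refine antitoneOn_of_deriv_nonpos (convex_Icc _ _) (by fun_prop)
      (fun s _ => (hd s).differentiableAt.differentiableWithinAt) fun s hs => ?_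
    rw [interior_Icc] at hs
    have h2 : m * s ≤ 1 := by
      have := hs.2.le
      rwa [le_div_iff₀ (by positivity), mul_comm] at this
    rw [(hd s).deriv]
    linarith [le_vpKernel hs.1 h2 (by nlinarith [hs.1, pi_gt_three])]
  have := anti (left_mem_Icc.2 (h0.trans h1)) ⟨h0, h1⟩ h0
  simp only [vpTail_zero] at this
  linarith

/-- The tail decreases on `[0, 2/m]`, so only the endpoint matters. There `m sin (1/m) ≥ 5/6` turns
`abs_vpTail_le` into `2.6/4 * 36/25 = 0.936`. -/
lemma le_vpTail {m : ℕ} (hm : 0 < m) {t : ℝ} (h0 : 0 ≤ t) (h1 : t ≤ 2 / m) :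
    -(m * 0.936) ≤ vpTail m t := by
  have hm' : (1 : ℝ) ≤ m := by exact_mod_cast hm
  have h2 : (0 : ℝ) < 2 / m := by positivity
  have hpi : (2 / m : ℝ) ≤ π := by
    rw [div_le_iff₀ (by positivity)]; nlinarith [pi_gt_three]
  refine le_trans ?_ (antitoneOn_vpTail hm ⟨h0, h1⟩ (right_mem_Icc.2 h2.le) h1)
  have h := (abs_le.1 (abs_vpTail_le hm h2 hpi)).1
  refine le_trans ?_ h
  rw [neg_le_neg_iff, one_sub_cos_eq, show (2 / m : ℝ) / 2 = 1 / m by ring]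
  have hs := sin_ge_sub_cube (x := 1 / m) (by positivity)
  have hs' : 5 / 6 ≤ m * sin (1 / m) := by
    have hle := mul_le_mul_of_nonneg_left hs (by positivity : (0 : ℝ) ≤ m)
    have e : (m : ℝ) * (1 / m - (1 / m) ^ 3 / 6) = 1 - (1 / m) ^ 2 / 6 := by
      field_simp
    have : (1 / m : ℝ) ^ 2 ≤ 1 := by
      apply pow_le_one₀ (by positivity)
      rw [div_le_one (by positivity)]; exact hm'
    linarith
  have hsq : 25 / 36 ≤ (m * sin (1 / m)) ^ 2 := by nlinarith
  have hpos : (0 : ℝ) < sin (1 / m) := by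
    by_contra! hneg
    nlinarith
  rw [div_le_iff₀ (by positivity)]
  linarith

/-- Split at `1/m` and `2/m`: a linear majorant, then a constant one (`π/2 - 0.63 < 0.941`), then
the `cot` estimate. The total is `π/2 - 0.315 + 0.941 + 1.3 < 3.5`. -/
lemma integral_abs_vpTail_le {m : ℕ} (hm : 0 < m) : ∫ t in 0..π, |vpTail m t| ≤ 3.5 := by
  have hm' : (1 : ℝ) ≤ m := by exact_mod_cast hm
  have hint : ∀ a b, IntervalIntegrable (fun t => |vpTail m t|) MeasureTheory.volume a b :=
    fun a b => Continuous.intervalIntegrable (by fun_prop) _ _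
  have hle : (1 / m : ℝ) ≤ 2 / m := by gcongr; norm_num
  have hpi : π < 3.1416 := pi_lt_d4
  have i1 : ∫ t in 0..(1 / m : ℝ), |vpTail m t| ≤ π / 2 - 0.315 := by
    calc ∫ t in 0..(1 / m : ℝ), |vpTail m t|
        ≤ ∫ t in 0..(1 / m : ℝ), (m * (π / 2) - 0.63 * m ^ 2 * t) := by
          refine integral_mono_on (by positivity) (hint _ _)
            (Continuous.intervalIntegrable (by fun_prop) _ _) fun t ht => ?_
          have h1 := vpTail_le hm ht.1 ht.2
          have h2 := le_vpTail hm ht.1 (ht.2.trans hle)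
          have h3 : m * t ≤ 1 := by
            have := ht.2
            rwa [le_div_iff₀ (by positivity), mul_comm] at this
          rw [abs_le]
          constructor
          · nlinarith [pi_gt_d2]
          · linarith
      _ = π / 2 - 0.315 := by
          rw [integral_sub (by simp) (Continuous.intervalIntegrable (by fun_prop) _ _),
            integral_const_mul (0.63 * (m : ℝ) ^ 2), integral_id, integral_const]
          simp only [sub_zero, smul_eq_mul]
          field_simp
          ring
  have i2 : ∫ t in (1 / m : ℝ)..(2 / m), |vpTail m t| ≤ 0.941 := by
    calc ∫ t in (1 / m : ℝ)..(2 / m), |vpTail m t|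
        ≤ ∫ t in (1 / m : ℝ)..(2 / m), (m : ℝ) * 0.941 := by
          refine integral_mono_on hle (hint _ _) (by simp) fun t ht => ?_
          have h0 : (0 : ℝ) ≤ 1 / m := by positivity
          have h1 := vpTail_le hm h0 le_rfl
          have h2 := le_vpTail hm (h0.trans ht.1) ht.2
          have h3 := antitoneOn_vpTail hm ⟨h0, hle⟩ ⟨h0.trans ht.1, ht.2⟩ ht.1
          have h4 : (m : ℝ) * (1 / m) = 1 := by field_simp
          rw [h4] at h1
          rw [abs_le]
          constructor <;> nlinarith
      _ = 0.941 := by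
          rw [integral_const, smul_eq_mul]
          field_simp
          norm_num
  have i3 := integral_abs_vpTail_two_div_le hm
  rw [← integral_add_adjacent_intervals (hint 0 (2 / m)) (hint _ _),
    ← integral_add_adjacent_intervals (hint 0 (1 / m)) (hint _ _)]
  linarith

/-! ### Singular integral form of the sums -/

lemma periodic_dirichletKernel (k : ℕ) : Function.Periodic (dirichletKernel k) (2 * π) := by
  intro t
  simp only [dirichletKernel]
  congr 1
  refine Finset.sum_congr rfl fun j _ => ?_
  rw [mul_add]
  exact cos_add_nat_mul_two_pi _ _

lemma dirichletKernel_neg (k : ℕ) (t : ℝ) : dirichletKernel k (-t) = dirichletKernel k t := by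
  simp [dirichletKernel]

lemma fourierSum_eq_integral_sub {f : ℝ → ℝ} (hf : Continuous f) (k : ℕ) (x : ℝ) :
    fourierSum k f x = 1 / π * ∫ t in (-π)..π, f t * dirichletKernel k (t - x) := by
  have h : ∀ t, f t * dirichletKernel k (t - x) = f t * cos ((0 : ℕ) * t) * (1 / 2) +
      ∑ j ∈ Finset.Icc 1 k, (f t * cos (j * t) * cos (j * x) + f t * sin (j * t) * sin (j * x)) :=
      fun t => by
    rw [dirichletKernel, mul_add, Finset.mul_sum]
    congr 1
    · simp
    · refine Finset.sum_congr rfl fun j _ => ?_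
      rw [mul_sub, cos_sub]; ring
  simp only [h]
  rw [integral_add (Continuous.intervalIntegrable (by fun_prop) _ _)
      (Continuous.intervalIntegrable (by fun_prop) _ _),
    integral_finsetSum fun j _ => Continuous.intervalIntegrable (by fun_prop) _ _,
    integral_mul_const, mul_add, Finset.mul_sum, fourierSum]
  congr 1
  · rw [cosCoeff]; ring
  · refine Finset.sum_congr rfl fun j _ => ?_
    rw [integral_add (Continuous.intervalIntegrable (by fun_prop) _ _)
      (Continuous.intervalIntegrable (by fun_prop) _ _), integral_mul_const, integral_mul_const,
      cosCoeff, sinCoeff]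
    ring

lemma fourierSum_eq_integral {f : ℝ → ℝ} (hf : f ∈ periodicC) (k : ℕ) (x : ℝ) :
    fourierSum k f x = 1 / π * ∫ t in 0..π, (f (x + t) + f (x - t)) * dirichletKernel k t := by
  obtain ⟨hc, hp⟩ := hf
  rw [fourierSum_eq_integral_sub hc]
  congr 1
  have hper : Function.Periodic (fun t => f t * dirichletKernel k (t - x)) (2 * π) := fun t => by
    simp only [hp t]
    rw [show t + 2 * π - x = t - x + 2 * π by ring, periodic_dirichletKernel k]
  have h1 := hper.intervalIntegral_add_eq (-π) (-π + x)
  rw [show -π + 2 * π = π by ring, show -π + x + 2 * π = π + x by ring,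
    ← integral_comp_add_right (fun t => f t * dirichletKernel k (t - x))] at h1
  simp only [add_sub_cancel_right] at h1
  rw [h1, ← integral_add_adjacent_intervals (b := 0)
    (Continuous.intervalIntegrable (by fun_prop) _ _)
    (Continuous.intervalIntegrable (by fun_prop) _ _)]
  have h2 := integral_comp_neg (a := 0) (b := π) (fun t => f (t + x) * dirichletKernel k t)
  rw [neg_zero] at h2
  rw [← h2, ← integral_add (Continuous.intervalIntegrable (by fun_prop) _ _)
    (Continuous.intervalIntegrable (by fun_prop) _ _)]
  refine integral_congr fun t _ => ?_
  simp only [dirichletKernel_neg]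
  rw [add_comm t x, neg_add_eq_sub]
  ring

/-- The de la Vallée Poussin mean for `n = 2 m`, `p = m` as a singular integral, which makes
sense for all continuous functions. -/
noncomputable def vpOperator (m : ℕ) (f : ℝ → ℝ) (x : ℝ) : ℝ :=
  1 / (m * π) * ∫ t in 0..π, (f (x + t) + f (x - t)) * vpKernel m t

lemma vpSum_eq_vpOperator {f : ℝ → ℝ} (hf : f ∈ periodicC) (m : ℕ) (x : ℝ) :
    vpSum (2 * m) m f x = vpOperator m f x := by
  have hc := hf.1
  have hk : ∀ t, vpKernel m t = ∑ k ∈ Finset.Ico m (2 * m), dirichletKernel k t := fun t => by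
    rw [Finset.sum_Ico_eq_sub _ (by omega)]; rfl
  rw [vpSum, vpOperator, show 2 * m - m = m by omega,
    Finset.sum_congr rfl fun k _ => fourierSum_eq_integral hf k x, ← Finset.mul_sum,
    ← integral_finsetSum fun j _ => Continuous.intervalIntegrable (by fun_prop) _ _]
  simp only [hk, Finset.mul_sum]
  rw [← mul_assoc]
  congr 1
  ring

/-! ### Approximation error for bounded and for Lipschitz functions -/

lemma vpOperator_sub {f g : ℝ → ℝ} (hf : Continuous f) (hg : Continuous g) (m : ℕ) (x : ℝ) :
    vpOperator m (f - g) x = vpOperator m f x - vpOperator m g x := by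
  rw [vpOperator, vpOperator, vpOperator, ← mul_sub,
    ← integral_sub (Continuous.intervalIntegrable (by fun_prop) _ _)
      (Continuous.intervalIntegrable (by fun_prop) _ _)]
  congr 1
  refine integral_congr fun t _ => ?_
  simp only [Pi.sub_apply]
  ring

lemma abs_sub_vpOperator_le_of_abs_le {e : ℝ → ℝ} (he : Continuous e) {δ : ℝ}
    (hδ : ∀ x, |e x| ≤ δ) {m : ℕ} (hm : 0 < m) (x : ℝ) :
    |e x - vpOperator m e x| ≤ 153 / 56 * δ := by
  have hm' : (0 : ℝ) < m := by exact_mod_cast hm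
  have hδ0 : 0 ≤ δ := (abs_nonneg _).trans (hδ 0)
  have h : |∫ t in 0..π, (e (x + t) + e (x - t)) * vpKernel m t| ≤
      2 * δ * (97 / 56 * (m * (π / 2))) := by
    calc |∫ t in 0..π, (e (x + t) + e (x - t)) * vpKernel m t|
        ≤ ∫ t in 0..π, |(e (x + t) + e (x - t)) * vpKernel m t| :=
          abs_integral_le_integral_abs pi_pos.le
      _ ≤ ∫ t in 0..π, 2 * δ * |vpKernel m t| := by
          refine integral_mono_on pi_pos.le (Continuous.intervalIntegrable (by fun_prop) _ _)
            (Continuous.intervalIntegrable (by fun_prop) _ _) fun t _ => ?_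
          rw [abs_mul]
          gcongr
          linarith [abs_add_le (e (x + t)) (e (x - t)), hδ (x + t), hδ (x - t)]
      _ ≤ _ := by
          rw [integral_const_mul]
          gcongr
          exact integral_abs_vpKernel_le m
  have hV : |vpOperator m e x| ≤ 97 / 56 * δ := by
    rw [vpOperator, abs_mul, abs_of_pos (by positivity)]
    calc _ ≤ 1 / (m * π) * (2 * δ * (97 / 56 * (m * (π / 2)))) := by gcongr
      _ = _ := by field_simp
  linarith [abs_sub (e x) (vpOperator m e x), hδ x]

lemma absolutelyContinuousOnInterval_vpTail (m : ℕ) :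
    AbsolutelyContinuousOnInterval (vpTail m) 0 π := by
  have h : deriv (vpTail m) = fun t => -vpKernel m t :=
    funext fun t => (hasDerivAt_vpTail m t).deriv
  have : ContDiff ℝ 1 (vpTail m) := contDiff_one_iff_deriv.2
    ⟨fun t => (hasDerivAt_vpTail m t).differentiableAt, by rw [h]; fun_prop⟩
  exact this.contDiffOn.absolutelyContinuousOnInterval

lemma abs_sub_vpOperator_le_of_lipschitz {f : ℝ → ℝ} {b : NNReal} (hf : LipschitzWith b f)
    {m : ℕ} (hm : 0 < m) (x : ℝ) : |f x - vpOperator m f x| ≤ 7 * b / (m * π) := by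
  have hm' : (0 : ℝ) < m := by exact_mod_cast hm
  have hc := hf.continuous
  set ψ : ℝ → ℝ := fun t => 2 * f x - (f (x + t) + f (x - t)) with hψ
  have hl : LipschitzWith (2 * b) ψ := LipschitzWith.of_dist_le_mul fun s t => by
    have h1 := hf.dist_le_mul (x + s) (x + t)
    have h2 := hf.dist_le_mul (x - s) (x - t)
    rw [dist_add_left] at h1
    rw [dist_sub_left] at h2
    rw [Real.dist_eq] at *
    rw [abs_le] at *
    push_cast
    constructor <;> simp only [hψ] <;> linarith
  have hac : AbsolutelyContinuousOnInterval ψ 0 π :=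
    (hl.lipschitzOnWith).absolutelyContinuousOnInterval
  have e1 : f x - vpOperator m f x = 1 / (m * π) * ∫ t in 0..π, ψ t * vpKernel m t := by
    simp only [hψ, sub_mul]
    rw [integral_sub (Continuous.intervalIntegrable (by fun_prop) _ _)
      (Continuous.intervalIntegrable (by fun_prop) _ _), integral_const_mul, integral_vpKernel,
      vpOperator]
    field_simp
  -- Both boundary terms vanish: `ψ 0 = 0` and the tail is zero at `π`. As `ψ` is only Lipschitz,
  -- the absolutely continuous form of integration by parts is used.
  have e2 : ∫ t in 0..π, ψ t * vpKernel m t = ∫ t in 0..π, deriv ψ t * vpTail m t := by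
    have h := hac.integral_mul_deriv_eq_deriv_mul (absolutelyContinuousOnInterval_vpTail m)
    have h0 : ψ 0 = 0 := by simp only [hψ, add_zero, sub_zero]; ring
    simp only [(hasDerivAt_vpTail m _).deriv, vpTail_pi, h0, mul_neg,
      intervalIntegral.integral_neg] at h
    linarith
  have e3 : |∫ t in 0..π, deriv ψ t * vpTail m t| ≤ 2 * b * 3.5 := by
    calc |∫ t in 0..π, deriv ψ t * vpTail m t|
        ≤ ∫ t in 0..π, |deriv ψ t * vpTail m t| := abs_integral_le_integral_abs pi_pos.le
      _ ≤ ∫ t in 0..π, 2 * b * |vpTail m t| := by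
          refine integral_mono_on pi_pos.le
            (hac.intervalIntegrable_deriv.mul_continuousOn (by fun_prop)).abs
            (Continuous.intervalIntegrable (by fun_prop) _ _) fun t _ => ?_
          rw [abs_mul]
          gcongr
          simpa using norm_deriv_le_of_lipschitz (x₀ := t) hl
      _ ≤ _ := by
          rw [integral_const_mul]
          gcongr
          exact integral_abs_vpTail_le hm
  rw [e1, e2, abs_mul, abs_of_pos (by positivity)]
  calc _ ≤ 1 / (m * π) * (2 * b * 3.5) := by gcongr
    _ = _ := by ring

/-! ### From Lipschitz to Hölder functions -/

/-- A function with modulus of continuity at most `a + b t` is within `a / 2` of a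
`b`-Lipschitz function. -/
lemma exists_lipschitzWith_abs_sub_le {f : ℝ → ℝ} {a : ℝ} {b : NNReal}
    (hf : ∀ x y, |f x - f y| ≤ a + b * |x - y|) :
    ∃ g, LipschitzWith b g ∧ ∀ x, |f x - g x| ≤ a / 2 := by
  have hbdd : ∀ x, BddBelow (range fun y => f y + b * |x - y|) := fun x => by
    refine ⟨f x - a, ?_⟩
    rintro _ ⟨y, rfl⟩
    linarith [(abs_le.1 (hf x y)).2]
  -- The infimal convolution lies between `f - a` and `f`; the shift by `a / 2` centres it.
  refine ⟨fun x => (⨅ y, (f y + b * |x - y|)) + a / 2, ?_, fun x => ?_⟩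
  · refine LipschitzWith.of_le_add_mul b fun x z => ?_
    have : (⨅ y, (f y + b * |x - y|)) - b * dist x z ≤ ⨅ y, (f y + b * |z - y|) := by
      refine le_ciInf fun y => ?_
      have h1 := ciInf_le (hbdd x) y
      have h2 := mul_le_mul_of_nonneg_left (abs_sub_le x z y) b.2
      rw [mul_add] at h2
      rw [Real.dist_eq]
      simp only [NNReal.val_eq_coe] at h2
      linarith
    linarith
  · have h1 := ciInf_le (hbdd x) x
    have h2 : f x - a ≤ ⨅ y, (f y + b * |x - y|) :=
      le_ciInf fun y => by linarith [(abs_le.1 (hf x y)).2]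
    simp only [sub_self, abs_zero, mul_zero, add_zero] at h1
    rw [abs_le]
    constructor <;> linarith

/-- Split `f = (f - g) + g` with `g` the Lipschitz approximant. Periodicity of `g` is not provided,
hence the integral operator in place of Fourier sums. -/
lemma abs_sub_vpOperator_le {f : ℝ → ℝ} (hc : Continuous f) {a : ℝ} {b : NNReal}
    (hf : ∀ x y, |f x - f y| ≤ a + b * |x - y|) {m : ℕ} (hm : 0 < m) (x : ℝ) :
    |f x - vpOperator m f x| ≤ 153 / 112 * a + 7 * b / (m * π) := by
  obtain ⟨g, hg, hfg⟩ := exists_lipschitzWith_abs_sub_le hf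
  have h1 := abs_sub_vpOperator_le_of_lipschitz hg hm x
  have h2 := abs_sub_vpOperator_le_of_abs_le (hc.sub hg.continuous) hfg hm x
  rw [vpOperator_sub hc hg.continuous, Pi.sub_apply] at h2
  rw [abs_le] at *
  constructor <;> linarith

/-- The tangent line at `L` of the concave function `t ↦ t ^ α`. -/
lemma rpow_le_tangent {α L t : ℝ} (h0 : 0 < α) (h1 : α ≤ 1) (hL : 0 < L) (ht : 0 ≤ t) :
    t ^ α ≤ (1 - α) * L ^ α + α * L ^ α / L * t := by
  have h := geom_mean_le_arith_mean2_weighted h0.le (sub_nonneg.2 h1)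
    (div_nonneg ht hL.le) zero_le_one (by ring)
  rw [one_rpow, mul_one, mul_one, div_rpow ht hL.le, div_le_iff₀ (by positivity)] at h
  refine h.trans_eq ?_
  ring

lemma abs_sub_vpSum_le {α : ℝ} (h0 : 0 < α) (h1 : α ≤ 1) {m : ℕ} (hm : 0 < m) {f : ℝ → ℝ}
    (hf : f ∈ holderClass α) (x : ℝ) :
    |f x - vpSum (2 * m) m f x| ≤ 1.43 * (π / (2 * m)) ^ α := by
  have hm' : (0 : ℝ) < m := by exact_mod_cast hm
  have hL : 0 < π / (2 * m) := by positivity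
  rw [vpSum_eq_vpOperator hf.1]
  obtain ⟨b, hb⟩ : ∃ b : NNReal, (b : ℝ) = α * (π / (2 * m)) ^ α / (π / (2 * m)) :=
    ⟨Real.toNNReal _, Real.coe_toNNReal _ (by positivity)⟩
  -- Tangency at `π/(2m)` makes the bound `153/112 (1 - α) + 14/π² α` times `(π/(2m))^α`; both
  -- coefficients are below `1.43`.
  have h := abs_sub_vpOperator_le hf.1.1 (a := (1 - α) * (π / (2 * m)) ^ α) (b := b)
    (fun x y => (hf.2 x y).trans (hb ▸ rpow_le_tangent h0 h1 hL (abs_nonneg _))) hm x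
  rw [hb] at h
  refine h.trans ?_
  set P := (π / (2 * m)) ^ α with hP
  have hP0 : 0 < P := by positivity
  have e : 7 * (α * P / (π / (2 * m))) / (m * π) = 14 / π ^ 2 * (α * P) := by field_simp; ring
  have hpi : 14 / π ^ 2 ≤ 1.43 := by
    rw [div_le_iff₀ (by positivity)]
    nlinarith [pi_gt_d2]
  have h2 := mul_le_mul_of_nonneg_right hpi (by positivity : 0 ≤ α * P)
  have h3 : 0 ≤ (1 - α) * P := mul_nonneg (sub_nonneg.2 h1) hP0.le
  rw [e]
  nlinarith

/-! ### The function giving the lower bound -/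

/-- The `α`-th power of the distance to the lattice `c ℤ`. -/
noncomputable def distPow (c α : ℝ) (t : ℝ) : ℝ := ‖(t : AddCircle c)‖ ^ α

lemma periodic_distPow (c α : ℝ) : Function.Periodic (distPow c α) c := fun t => by
  simp [distPow]

lemma continuous_distPow (c : ℝ) {α : ℝ} (h0 : 0 < α) : Continuous (distPow c α) := by
  have : Continuous fun t : ℝ => ‖(t : AddCircle c)‖ :=
    continuous_norm.comp (AddCircle.continuous_mk' c)
  exact this.rpow_const fun _ => Or.inr h0.le

lemma abs_rpow_sub_rpow_le {a b α : ℝ} (ha : 0 ≤ a) (hb : 0 ≤ b) (h0 : 0 < α) (h1 : α ≤ 1) :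
    |a ^ α - b ^ α| ≤ |a - b| ^ α := by
  wlog hab : b ≤ a generalizing a b
  · rw [abs_sub_comm, abs_sub_comm a]
    exact this hb ha (le_of_not_ge hab)
  have h := rpow_add_le_add_rpow (sub_nonneg.2 hab) hb h0.le h1
  rw [sub_add_cancel] at h
  rw [abs_of_nonneg (sub_nonneg.2 hab),
    abs_of_nonneg (sub_nonneg.2 (rpow_le_rpow hb hab h0.le))]
  linarith

lemma abs_distPow_sub_le (c : ℝ) {α : ℝ} (h0 : 0 < α) (h1 : α ≤ 1) (x y : ℝ) :
    |distPow c α x - distPow c α y| ≤ |x - y| ^ α := by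
  refine (abs_rpow_sub_rpow_le (norm_nonneg _) (norm_nonneg _) h0 h1).trans ?_
  refine rpow_le_rpow (abs_nonneg _) ?_ h0.le
  refine (abs_norm_sub_norm_le _ _).trans ?_
  rw [← QuotientAddGroup.mk_sub]
  exact (QuotientAddGroup.norm_mk_le_norm).trans_eq (Real.norm_eq_abs _)

lemma distPow_mem_holderClass {n : ℕ} (hn : 0 < n) {α : ℝ} (h0 : 0 < α) (h1 : α ≤ 1) :
    distPow (2 * π / n) α ∈ holderClass α := by
  refine ⟨⟨continuous_distPow _ h0, ?_⟩, abs_distPow_sub_le _ h0 h1⟩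
  have h := (periodic_distPow (2 * π / n) α).nat_mul n
  rwa [mul_div_cancel₀ _ (by positivity)] at h

lemma integral_distPow {n : ℕ} (hn : 0 < n) {α : ℝ} (h0 : 0 < α) :
    ∫ t in (-π)..π, distPow (2 * π / n) α t = 2 * π * (1 / (α + 1) * (π ^ α / n ^ α)) := by
  have hn' : (0 : ℝ) < n := by exact_mod_cast hn
  have hc : 0 < 2 * π / n := by positivity
  have hint : ∀ a b, IntervalIntegrable (distPow (2 * π / n) α) MeasureTheory.volume a b :=
    fun a b => (continuous_distPow _ h0).intervalIntegrable _ _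
  have h1 := (periodic_distPow (2 * π / n) α).intervalIntegral_add_zsmul_eq n (-π) hint
  have h2 := (periodic_distPow (2 * π / n) α).intervalIntegral_add_eq (-π) (-(π / n))
  have e1 : -π + (n : ℤ) • (2 * π / n) = π := by
    simp only [zsmul_eq_mul, Int.cast_natCast]; field_simp; ring
  have e2 : -(π / n) + 2 * π / n = π / n := by ring
  rw [e1, h2, e2] at h1
  have heq : ∀ t ∈ Icc (-(π / n)) (π / n), distPow (2 * π / n) α t = |t| ^ α := fun t ht => by
    rw [distPow, (AddCircle.norm_coe_eq_abs_iff _ hc.ne').2]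
    rw [abs_of_pos hc, abs_le]
    have e3 : 2 * π / n / 2 = π / n := by ring
    rw [e3]
    exact ht
  have hpn : 0 < π / n := by positivity
  have half : ∫ t in 0..(π / n), distPow (2 * π / n) α t = (π / n) ^ (α + 1) / (α + 1) := by
    rw [integral_congr (g := fun t => t ^ α), integral_rpow (Or.inl (by linarith)),
      zero_rpow (by linarith), sub_zero]
    intro t ht
    rw [uIcc_of_le hpn.le] at ht
    simp only [heq t ⟨by linarith [ht.1], ht.2⟩, abs_of_nonneg ht.1]
  have hneg : ∫ t in (-(π / n))..0, distPow (2 * π / n) α t =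
      ∫ t in 0..(π / n), distPow (2 * π / n) α t := by
    have := integral_comp_neg (a := 0) (b := π / n) (distPow (2 * π / n) α)
    rw [neg_zero] at this
    rw [← this]
    simp [distPow]
  rw [h1, ← integral_add_adjacent_intervals (hint _ 0) (hint _ _), hneg, half,
    rpow_add_one hpn.ne', div_rpow pi_pos.le hn'.le]
  simp only [zsmul_eq_mul, Int.cast_natCast]
  field_simp
  ring

/-- Translation by the period `2π/n` rotates the pair of `j`-th coefficients by the angle `2πj/n`.
This is not a multiple of `2π`, so the only fixed vector is zero. -/
lemma fourierCoeff_eq_zero_of_periodic {f : ℝ → ℝ} (hf : Continuous f) {n : ℕ}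
    (hp : Function.Periodic f (2 * π / n)) {j : ℕ} (h1 : 1 ≤ j) (h2 : j < n) :
    cosCoeff f j = 0 ∧ sinCoeff f j = 0 := by
  have hn' : (0 : ℝ) < n := by exact_mod_cast (by omega : 0 < n)
  set c := 2 * π / n with hc
  have hp' : Function.Periodic f (2 * π) := by
    have h := hp.nat_mul n
    rwa [hc, mul_div_cancel₀ _ hn'.ne'] at h
  have shift : ∀ g : ℝ → ℝ, Function.Periodic g (2 * π) →
      ∫ t in (-π)..π, f t * g (j * t) = ∫ t in (-π)..π, f t * g (j * t + j * c) := fun g hg => by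
    have hper : Function.Periodic (fun t => f t * g (j * t)) (2 * π) := fun t => by
      simp only [hp' t, mul_add]
      rw [hg.nat_mul j]
    have h := hper.intervalIntegral_add_eq (-π) (-π + c)
    rw [show -π + 2 * π = π by ring, show -π + c + 2 * π = π + c by ring,
      ← integral_comp_add_right (fun t => f t * g (j * t))] at h
    simp only [hp _, mul_add] at h
    exact h
  have hC := shift cos cos_periodic
  have hS := shift sin sin_periodic
  simp only [cos_add, sin_add, mul_add, mul_sub, ← mul_assoc] at hC hS
  rw [integral_sub (Continuous.intervalIntegrable (by fun_prop) _ _)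
    (Continuous.intervalIntegrable (by fun_prop) _ _), integral_mul_const,
    integral_mul_const] at hC
  rw [integral_add (Continuous.intervalIntegrable (by fun_prop) _ _)
    (Continuous.intervalIntegrable (by fun_prop) _ _), integral_mul_const,
    integral_mul_const] at hS
  have hcos : cos (j * c) < 1 := by
    have hj : (0 : ℝ) < j := by exact_mod_cast h1
    have hjn : (j : ℝ) < n := by exact_mod_cast h2
    have hjc : j * c < 2 * π := by
      rw [hc, ← mul_div_assoc, div_lt_iff₀ hn', mul_comm]
      have := pi_pos
      gcongr
    have hjc0 : 0 < j * c := by positivity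
    refine lt_of_le_of_ne (cos_le_one _) fun h => ?_
    exact hjc0.ne' ((cos_eq_one_iff_of_lt_of_lt (by linarith) hjc).1 h)
  have hne : 1 - cos (j * c) ≠ 0 := by linarith
  have hd : (1 - cos (j * c)) ^ 2 + sin (j * c) ^ 2 ≠ 0 := by positivity
  unfold cosCoeff sinCoeff
  generalize (∫ t in (-π)..π, f t * cos (j * t)) = I at *
  generalize (∫ t in (-π)..π, f t * sin (j * t)) = J at *
  constructor
  · rw [(mul_eq_zero.1 (by linear_combination (1 - cos (j * c)) * hC - sin (j * c) * hS :
      ((1 - cos (j * c)) ^ 2 + sin (j * c) ^ 2) * I = 0)).resolve_left hd, mul_zero]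
  · rw [(mul_eq_zero.1 (by linear_combination (1 - cos (j * c)) * hS + sin (j * c) * hC :
      ((1 - cos (j * c)) ^ 2 + sin (j * c) ^ 2) * J = 0)).resolve_left hd, mul_zero]

lemma vpSum_eq_mean_of_periodic {f : ℝ → ℝ} (hf : Continuous f) {n p : ℕ} (hp0 : 0 < p)
    (hpn : p ≤ n) (hp : Function.Periodic f (2 * π / n)) (x : ℝ) :
    vpSum n p f x = cosCoeff f 0 / 2 := by
  have h : ∀ k ∈ Finset.Ico (n - p) n, fourierSum k f x = cosCoeff f 0 / 2 := fun k hk => by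
    rw [fourierSum, Finset.sum_eq_zero, add_zero]
    intro j hj
    have h1 := Finset.mem_Icc.1 hj
    have h2 := (Finset.mem_Ico.1 hk).2
    obtain ⟨hc, hs⟩ := fourierCoeff_eq_zero_of_periodic hf hp h1.1 (h1.2.trans_lt h2)
    rw [hc, hs]; ring
  have hp' : (p : ℝ) ≠ 0 := by positivity
  rw [vpSum, Finset.sum_congr rfl h, Finset.sum_const, Nat.card_Ico,
    show n - (n - p) = p by omega, nsmul_eq_mul]
  field_simp

lemma abs_distPow_sub_vpSum_zero {n p : ℕ} (hp0 : 0 < p) (hpn : p ≤ n) {α : ℝ} (h0 : 0 < α) :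
    |distPow (2 * π / n) α 0 - vpSum n p (distPow (2 * π / n) α) 0| =
      1 / (α + 1) * (π ^ α / n ^ α) := by
  have hz : distPow (2 * π / n) α 0 = 0 := by simp [distPow, zero_rpow h0.ne']
  rw [hz, vpSum_eq_mean_of_periodic (continuous_distPow _ h0) hp0 hpn (periodic_distPow _ _),
    cosCoeff, zero_sub, abs_neg]
  simp only [Nat.cast_zero, zero_mul, cos_zero, mul_one]
  rw [integral_distPow (by omega) h0, abs_of_nonneg (by positivity)]
  field_simp

/-! ### Bounds for the supremum and numerical constants -/

lemma zero_mem_holderClass (α : ℝ) : (fun _ => 0) ∈ holderClass α :=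
  ⟨⟨continuous_const, fun _ => rfl⟩, fun x y => by
    simp only [sub_self, abs_zero]; exact rpow_nonneg (abs_nonneg _) _⟩

lemma deviations_le {α : ℝ} (h0 : 0 < α) (h1 : α ≤ 1) {m : ℕ} (hm : 0 < m) :
    ∀ d ∈ deviations (holderClass α) (2 * m) m, d ≤ 1.43 * (π / (2 * m)) ^ α := by
  rintro _ ⟨f, hf, rfl⟩
  exact ciSup_le fun x => abs_sub_vpSum_le h0 h1 hm hf x

lemma bddAbove_deviations {α : ℝ} (h0 : 0 < α) (h1 : α ≤ 1) {m : ℕ} (hm : 0 < m) :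
    BddAbove (deviations (holderClass α) (2 * m) m) := ⟨_, deviations_le h0 h1 hm⟩

lemma devSup_le {α : ℝ} (h0 : 0 < α) (h1 : α ≤ 1) {m : ℕ} (hm : 0 < m) :
    devSup (holderClass α) (2 * m) m ≤ 1.43 * (π / (2 * m)) ^ α :=
  csSup_le ⟨_, mem_image_of_mem _ (zero_mem_holderClass α)⟩ (deviations_le h0 h1 hm)

lemma le_devSup {α : ℝ} (h0 : 0 < α) (h1 : α ≤ 1) {m : ℕ} (hm : 0 < m) :
    1 / (α + 1) * (π ^ α / (2 * m : ℕ) ^ α) ≤ devSup (holderClass α) (2 * m) m := by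
  have hf := distPow_mem_holderClass (n := 2 * m) (by omega) h0 h1
  -- An unbounded real supremum defaults to `0`, so the lower bound needs the upper estimate, both
  -- for the class and for the norm.
  refine le_csSup_of_le (bddAbove_deviations h0 h1 hm) (mem_image_of_mem _ hf) ?_
  rw [← abs_distPow_sub_vpSum_zero hm (by omega) h0]
  refine le_ciSup (f := fun x => |distPow (2 * π / (2 * m : ℕ)) α x -
    vpSum (2 * m) m (distPow (2 * π / (2 * m : ℕ)) α) x|) ⟨1.43 * (π / (2 * m)) ^ α, ?_⟩ 0
  rintro _ ⟨x, rfl⟩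
  exact abs_sub_vpSum_le h0 h1 hm hf x

/-- The right side decreases in `α`, so `α = 1` is the worst case, with value `6/7 + 46/(25π) ≈
1.4428`. -/
lemma lt_upper_constant {α : ℝ} (h1 : α ≤ 1) :
    1.43 < (6 : ℝ) ^ α / (7 : ℝ) ^ α
      + (3 : ℝ) ^ (2 - α) * (2 : ℝ) ^ (α - 1) / (5 * π) + 31 / (25 * π) := by
  have e1 : (6 : ℝ) / 7 ≤ (6 : ℝ) ^ α / (7 : ℝ) ^ α := by
    rw [← div_rpow (by norm_num) (by norm_num)]
    simpa using rpow_le_rpow_of_exponent_ge (by norm_num : (0 : ℝ) < 6 / 7) (by norm_num) h1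
  have e2 : (3 : ℝ) ≤ (3 : ℝ) ^ (2 - α) * (2 : ℝ) ^ (α - 1) := by
    have h : (3 : ℝ) ^ (2 - α) * (2 : ℝ) ^ (α - 1) = 3 * (3 / 2 : ℝ) ^ (1 - α) := by
      rw [div_rpow (by norm_num) (by norm_num), show 2 - α = 1 + (1 - α) by ring,
        rpow_add (by norm_num), rpow_one, show α - 1 = -(1 - α) by ring,
        rpow_neg (by norm_num), mul_assoc, div_eq_mul_inv]
    have := one_le_rpow (by norm_num : (1 : ℝ) ≤ 3 / 2) (sub_nonneg.2 h1)
    rw [h]; linarith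
  have e3 : 3 / (5 * π) ≤ (3 : ℝ) ^ (2 - α) * (2 : ℝ) ^ (α - 1) / (5 * π) := by gcongr
  have e4 : (0.58 : ℝ) < 3 / (5 * π) + 31 / (25 * π) := by
    rw [show 3 / (5 * π) + 31 / (25 * π) = 46 / (25 * π) by field_simp; norm_num,
      lt_div_iff₀ (by positivity)]
    linarith [pi_lt_d2]
  norm_num at e4 ⊢
  linarith

end ValleePoussin


theorem mainTheorem3 (n : ℕ) (hn : 0 < n) (hn2 : Even n) :
    (∀ α : ℝ, 0 < α → α ≤ 1 →
      BddAbove (ValleePoussin.deviations (ValleePoussin.holderClass α) n (n / 2)) ∧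
      1 / (α + 1) * (Real.pi ^ α / (n : ℝ) ^ α) ≤
        ValleePoussin.devSup (ValleePoussin.holderClass α) n (n / 2) ∧
      ValleePoussin.devSup (ValleePoussin.holderClass α) n (n / 2) <
        ((6 : ℝ) ^ α / (7 : ℝ) ^ α
          + (3 : ℝ) ^ (2 - α) * (2 : ℝ) ^ (α - 1) / (5 * Real.pi)
          + 31 / (25 * Real.pi)) * (Real.pi ^ α / (n : ℝ) ^ α)) ∧
    (Real.pi / (2 * n) ≤ ValleePoussin.devSup (ValleePoussin.holderClass 1) n (n / 2) ∧
      ValleePoussin.devSup (ValleePoussin.holderClass 1) n (n / 2) < 1.443 * Real.pi / n) ∧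
    (2 / 3 * Real.sqrt (Real.pi / n) ≤
        ValleePoussin.devSup (ValleePoussin.holderClass (1 / 2)) n (n / 2) ∧
      ValleePoussin.devSup (ValleePoussin.holderClass (1 / 2)) n (n / 2) <
        1.555 * Real.sqrt (Real.pi / n)) := by
  obtain ⟨m, hm⟩ := hn2.exists_two_nsmul n
  rw [nsmul_eq_mul, Nat.cast_ofNat] at hm
  subst hm
  have hm : 0 < m := by omega
  have hm' : (0 : ℝ) < m := by exact_mod_cast hm
  have hpi := Real.pi_pos
  rw [Nat.mul_div_cancel_left m two_pos]
  have hL : 0 < Real.pi / (2 * m : ℕ) := by positivity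
  have lower := fun (α : ℝ) (h0 : 0 < α) (h1 : α ≤ 1) => ValleePoussin.le_devSup h0 h1 hm
  have upper := fun (α : ℝ) (h0 : 0 < α) (h1 : α ≤ 1) => ValleePoussin.devSup_le h0 h1 hm
  have cast : (2 * m : ℝ) = (2 * m : ℕ) := by push_cast; rfl
  rw [cast] at upper
  have l1 := lower 1 one_pos le_rfl
  have u1 := upper 1 one_pos le_rfl
  have l2 := lower (1 / 2) (by norm_num) (by norm_num)
  have u2 := upper (1 / 2) (by norm_num) (by norm_num)
  rw [Real.rpow_one, Real.rpow_one] at l1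
  rw [Real.rpow_one] at u1
  rw [← Real.div_rpow hpi.le (by positivity), ← Real.sqrt_eq_rpow] at l2
  rw [← Real.sqrt_eq_rpow] at u2
  refine ⟨fun α h0 h1 => ⟨ValleePoussin.bddAbove_deviations h0 h1 hm, lower α h0 h1, ?_⟩,
    ⟨?_, ?_⟩, ?_, ?_⟩
  · refine (upper α h0 h1).trans_lt ?_
    rw [← Real.div_rpow hpi.le (by positivity)]
    exact mul_lt_mul_of_pos_right (ValleePoussin.lt_upper_constant h1) (by positivity)
  · refine Eq.trans_le ?_ l1
    rw [div_mul_eq_div_div]; ring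
  · refine u1.trans_lt ?_
    rw [mul_div_assoc]
    gcongr
    norm_num
  · refine Eq.trans_le ?_ l2
    norm_num
  · refine u2.trans_lt ?_
    have := Real.sqrt_pos.2 hL
    gcongr
    norm_num
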